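/- All codes are binary. Let $H(p)=-p\log_2 p-(1-p)\log_2(1-p)$. The rate of $\mathcal C\subseteq\mathbb F_2^N$ is $\log_2|\mathcal C|/N$; its covering radius is the least $r$ such that every word of $\mathbb F_2^N$ is at Hamming distance at most $r$ from $\mathcal C$, and its relative covering radius is that number divided by $N$. **Construction.** Let $a,b\ge 1$, $n=\max(a,b)$, $c>0$, $t=\lceil c\log_2 n\rceil$. Fix an $\mathbb F_2$-basis of $\mathbb F_{2^n}$, and for $\alpha\in\mathbb F_{2^n}$ let $M_\alpha\in\mathbb F_2^{n\times n}$ be the matrix of multiplication by $\alpha$ acting on row vectors. For $\alpha\in\mathbb F_{2^n}$ and $M\in\mathbb F_2^{t\times(a+b)}$ let $C_{\alpha,M}\subseteq\mathbb F_2^{a+b}$ be the row space of $$\begin{bmatrix} I_a \mid M_\alpha[[a],[b]]\\ M\end{bmatrix},$$ where $M_\alpha[[a],[b]]$ is the submatrix of the first $a$ rows and first $b$ columns of $M_\alpha$. (For $a=b=n$ this is a Wozencraft code with $t$ extra generators; for $a<b$ it is punctured, for $a>b$ truncated.) Let $$\mathcal D_{a,b}=\bigoplus_{\alpha\in\mathbb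 F_{2^n},\ M\in\mathbb F_2^{t\times(a+b)}}C_{\alpha,M},$$ a linear code of block length $N_{a,b}=(a+b)\,2^{n+t(a+b)}$. **Theorem.** There is an absolute constant $c>0$ such that for every $0<\delta<\tfrac12$ there is a constant $C=C(\delta)>0$ with the following properties, in each of which the bounds on radius and rate hold for every choice of the basis of $\mathbb F_{2^n}$. 1. For every $0<\varepsilon\le\tfrac12$ there are $a,b\ge1$ such that $N_{a,b}\le\exp\!\big(C\,\tfrac1\varepsilon\log\tfrac1\varepsilon\big)$, and $\mathcal D_{a,b}$ has relative covering radius at most $\delta+\varepsilon$ and rate $R$ with $|R-(1-H(\delta))|\le C\,\varepsilon\log\tfrac1\varepsilon$. 2. For every $0<\varepsilon\le\tfrac12$ there are $a,b\ge1$ such that $N_{a,b}\le\exp\!\big(C\,\tfrac1\varepsilon\log^2\tfrac1\varepsilon\big)$, and $\mathcal D_{a,b}$ has relative covering radius at most $\delta+\varepsilon$ and rate $R$ with $1-H(\delta)-C\varepsilon\le R\le 1-H(\delta)$. 3. For all sufficiently large $m$ (depending on $\delta$), put $a=\lfloor(1-H(\delta))m\rfloor$, $b=m-a$ and $N=N_{a,b}$.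 Then $\mathcal D_{a,b}$ has relative covering radius at most $\delta+C\,\frac{(\log\log N)^2}{\log N}$ and rate $R$ with $|R-(1-H(\delta))|\le C\,\frac{(\log\log N)^2}{\log N}$; that is, the gap to the sphere-covering bound is $\tilde O_\delta(1/\log N)$. -/

import Mathlib

namespace CoveringCode

noncomputable section

/-- The binary entropy function, with logarithms to the base two. -/
def entropy (p : ℝ) : ℝ := Real.binEntropy p / Real.log 2

/-- The covering radius of a code `C ⊆ 𝔽₂^X` (coordinates indexed by a finite set `X`): the smallest
`r` such that every word is at Hamming distance at most `r` from a codeword. For a nonempty code,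
such an `r` exists. -/
def coveringRadius {X : Type*} [Fintype X] (C : Set (X → ZMod 2)) : ℕ :=
  sInf {r : ℕ | ∀ z : X → ZMod 2, ∃ w ∈ C, hammingDist z w ≤ r}

/-- The covering radius divided by the block length. -/
def relCoveringRadius {X : Type*} [Fintype X] (C : Set (X → ZMod 2)) : ℝ :=
  (coveringRadius C : ℝ) / (Fintype.card X : ℝ)

/-- The rate `log₂ |C| / (block length)`. -/
def rate {X : Type*} [Fintype X] (C : Set (X → ZMod 2)) : ℝ :=
  Real.logb 2 (Nat.card C : ℝ) / (Fintype.card X : ℝ)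

/-- The linear code generated by the matrix `G`: the span of its rows. -/
def codeOf {R X : Type*} (G : Matrix R X (ZMod 2)) : Submodule (ZMod 2) (X → ZMod 2) :=
  Submodule.span (ZMod 2) (Set.range fun r => G r)

/-- The direct sum of a family of codes of the same block length; the coordinates are indexed by
pairs (summand, coordinate in the summand). -/
def directSum {ι X : Type*} (C : ι → Submodule (ZMod 2) (X → ZMod 2)) :
    Submodule (ZMod 2) (ι × X → ZMod 2) where
  carrier := {w | ∀ i, (fun x => w (i, x)) ∈ C i}
  add_mem' := fun hv hw i => (C i).add_mem (hv i) (hw i)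
  zero_mem' := fun i => (C i).zero_mem
  smul_mem' := fun s _ hw i => (C i).smul_mem s (hw i)

/-- The matrix `M_α` of multiplication by `α ∈ 𝔽_{2^n}` on row vectors, where `𝔽_{2^n}` is identified
with `𝔽₂^n` by the basis `β`: row `i` holds the coordinates of `α * β i`. -/
def mulMatrix {n : ℕ} (β : Module.Basis (Fin n) (ZMod 2) (GaloisField 2 n))
    (α : GaloisField 2 n) : Matrix (Fin n) (Fin n) (ZMod 2) :=
  Matrix.of fun i j => β.repr (α * β i) j

/-- The generator matrix `[I_n | M_α]` of the Wozencraft code `{(x, α x)}`. -/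
def wozencraft {n : ℕ} (β : Module.Basis (Fin n) (ZMod 2) (GaloisField 2 n))
    (α : GaloisField 2 n) : Matrix (Fin n) (Fin n ⊕ Fin n) (ZMod 2) :=
  Matrix.fromCols 1 (mulMatrix β α)

/-- The restricted Wozencraft matrix `[I_a | M_α[[a],[b]]]`, where `n = max a b`. The choice
`a = b = n` gives `[I_n | M_α]`, the choice `a = k ≤ n = b` gives the punctured matrix
`[I_k | M_α[[k],[n]]]`, and `a = n ≥ k = b` gives the truncated matrix `[I_n | M_α[[n],[k]]]`. -/
def restrictedWozencraft (a b : ℕ)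
    (β : Module.Basis (Fin (max a b)) (ZMod 2) (GaloisField 2 (max a b)))
    (α : GaloisField 2 (max a b)) : Matrix (Fin a) (Fin a ⊕ Fin b) (ZMod 2) :=
  (wozencraft β α).submatrix (Fin.castLE (le_max_left a b))
    (Sum.map (Fin.castLE (le_max_left a b)) (Fin.castLE (le_max_right a b)))

/-- The index set of the Wozencraft-type ensemble: an element `α` of `𝔽_{2^n}`, `n = max a b`, and
an arbitrary matrix `M` with `t` rows. -/
abbrev Index (a b t : ℕ) : Type :=
  GaloisField 2 (max a b) × Matrix (Fin t) (Fin a ⊕ Fin b) (ZMod 2)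

instance (a b t : ℕ) : Fintype (Index a b t) := Fintype.ofFinite _

/-- The generator matrix of the member `(α, M)` of the ensemble: `M` is put below the restricted
Wozencraft matrix. -/
def generator {a b t : ℕ}
    (β : Module.Basis (Fin (max a b)) (ZMod 2) (GaloisField 2 (max a b)))
    (i : Index a b t) : Matrix (Fin a ⊕ Fin t) (Fin a ⊕ Fin b) (ZMod 2) :=
  Matrix.fromRows (restrictedWozencraft a b β i.1) i.2

/-- The number `⌈c log₂ n⌉` of additional rows, where `n = max a b`. -/
def numRows (c : ℝ) (a b : ℕ) : ℕ := ⌈c * Real.logb 2 ((max a b : ℕ) : ℝ)⌉₊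

/-- The coordinates of the direct sum of the ensemble. -/
abbrev Coord (c : ℝ) (a b : ℕ) : Type := Index a b (numRows c a b) × (Fin a ⊕ Fin b)

/-- The construction: the direct sum of all members of the Wozencraft-type ensemble. -/
def construction (c : ℝ) (a b : ℕ)
    (β : Module.Basis (Fin (max a b)) (ZMod 2) (GaloisField 2 (max a b))) :
    Submodule (ZMod 2) (Coord c a b → ZMod 2) :=
  directSum fun i => codeOf (generator β i)

/-- The block length of the construction. -/
def blockLength (c : ℝ) (a b : ℕ) : ℕ := Fintype.card (Coord c a b)

end

end CoveringCode

/-!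
Let `m = a + b` and let `V` be the volume of a Hamming ball of radius `r` in `𝔽₂ ^ m`. The heart of
the proof is that, with `t = ⌈log₂ n⌉` additional rows, all but a fraction `4 * 2 ^ b / V` of the
codes `C_{α,M}` have covering radius at most `r` (`card_not_covering_mul_le`). This takes two steps.

* Second moment over `α`. The number of codewords of the restricted Wozencraft code of `α` within
  distance `r` of a word `z` has mean `μ = V / 2 ^ b` over `z`, for every `α`. Since every word with
  first `a` coordinates not all zero lies in at most a fraction `2 ^ (-b)` of the codes
  (`card_wozencraft_preimage_mul_le`), the variance over `(α, z)` is at most `μ`. Only first moments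
  over `α` enter here: by linearity, the second moment over `z` is a sum over single codewords.
  By Chebyshev's inequality, a fraction at most `1 / μ` of the pairs `(α, z)` is uncovered
  (`sum_card_uncovered_mul_le`).
* Doubling over `M`. Adjoining a random vector squares the density of the uncovered words on
  average. If `q` is the density before adjoining `t` vectors, then the probability that some word
  remains uncovered is at most `q * 2 ^ (m / 2 ^ t)` (`card_exists_coset_subset_le`), which is at
  most `4 * q` because `2 ^ t ≥ n ≥ m / 2`.

When `V ≥ m * 2 ^ b`, the exceptional codes form a fraction at most `4 / m`, and their covering
radii are at most `m`, so the direct sum has relative covering radius at most `(r + 4) / m`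
(`relCoveringRadius_construction_le`). The entropy bound `2 ^ (m H(r / m)) ≤ (m + 1) * m.choose r`
and the concavity of `H` turn the condition on `V` into
`b + 2 log₂ (m + 1) ≤ m H(δ) + κ x` for `r = ⌈δ m + x⌉`, where `κ` is the slope of the chord of `H`
from `δ` to `1 / 2` (`relCoveringRadius_construction_le_add`).

The rate lies between `a / m` and `(a + t) / m`, and the logarithm of the block length is of order
`m log m`. The three parts of the theorem differ in where the loss of order `log m / m` goes: into
the rate, with `x = 0` and `m` of order `1 / ε`; into both radius and rate, with `a + t` kept below
`(1 - H(δ)) m` and `m` of order `(1 / ε) log (1 / ε)`; or into both, with `a = ⌊(1 - H(δ)) m⌋`.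
-/

namespace CoveringCode

/-! ### The doubling argument -/

/-- Adjoining a uniformly random vector to a code replaces the set `U` of uncovered words by
`U ∩ (U - v)`, which squares its density on average; `min 1 (x ^ 2) ≤ x` turns this into an
induction that never leaves first moments. The factor `L` is an upper bound for
`|W| ^ (1 / 2 ^ t)`. -/
theorem card_exists_coset_subset_le {W : Type*} [AddCommGroup W] [Module (ZMod 2) W] [Fintype W]
    (t : ℕ) (L : ℝ) (hL : 0 ≤ L) (h : (Fintype.card W : ℝ) ≤ L ^ 2 ^ t) (U : Finset W)
    (S : Finset (Fin t → W)) (hS : ∀ M ∈ S, ∃ z, ∀ c : Fin t → ZMod 2, z + ∑ i, c i • M i ∈ U) :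
    (S.card : ℝ) * Fintype.card W ≤ L * U.card * (Fintype.card W : ℝ) ^ t := by
  classical
  induction t generalizing L U with
  | zero =>
    rcases S.eq_empty_or_nonempty with rfl | ⟨M, hM⟩
    · simp only [Finset.card_empty, Nat.cast_zero, zero_mul]
      positivity
    · have h1 : (S.card : ℝ) ≤ 1 := by
        exact_mod_cast (Finset.card_le_univ _).trans (by simp)
      obtain ⟨z, hz⟩ := hS M hM
      have h2 : (1 : ℝ) ≤ U.card := by exact_mod_cast Finset.card_pos.2 ⟨_, hz 0⟩
      simp only [pow_zero, pow_one, mul_one] at h ⊢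
      nlinarith [(Nat.cast_nonneg (Fintype.card W) : (0 : ℝ) ≤ _)]
  | succ t ih =>
    set w : ℝ := (Fintype.card W : ℝ) with hw
    have hw0 : 0 ≤ w := Nat.cast_nonneg _
    let V : W → Finset W := fun v => {z | z ∈ U ∧ z + v ∈ U}
    let T : W → Finset (Fin t → W) := fun v =>
      {M | ∃ z, ∀ c : Fin t → ZMod 2, z + ∑ i, c i • M i ∈ V v}
    have hST : S.card ≤ ∑ v, (T v).card := by
      rw [← Finset.card_sigma]
      refine Finset.card_le_card_of_injOn (fun M => ⟨M 0, Fin.tail M⟩) ?_ ?_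
      · intro M hM
        obtain ⟨z, hz⟩ := hS M hM
        simp only [Finset.coe_sigma, Set.mem_sigma_iff, Finset.mem_coe, Finset.mem_univ, true_and,
          T, V, Finset.mem_filter]
        refine ⟨z, fun c => ⟨?_, ?_⟩⟩
        · simpa [Fin.sum_univ_succ, Fin.tail] using hz (Fin.cons 0 c)
        · have := hz (Fin.cons 1 c)
          simp only [Fin.sum_univ_succ, Fin.cons_zero, Fin.cons_succ, one_smul] at this
          simp only [Fin.tail]
          convert this using 1
          abel
      · intro M _ M' _ hMM
        simp only [Sigma.mk.injEq, heq_eq_eq] at hMM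
        rw [← Fin.cons_self_tail M, ← Fin.cons_self_tail M', hMM.1, hMM.2]
    have hV : ∑ v, ((V v).card : ℝ) = (U.card : ℝ) ^ 2 := by
      have : ∑ v, (V v).card = U.card * U.card := by
        simp only [V, Finset.card_filter]
        rw [Finset.sum_comm]
        have : ∀ z, ∑ v, (if z ∈ U ∧ z + v ∈ U then 1 else 0) = if z ∈ U then U.card else 0 := by
          intro z
          split_ifs with hz
          · simp only [hz, true_and]
            rw [Fintype.sum_equiv (Equiv.addLeft z) _ (fun v => if v ∈ U then 1 else 0)
              (fun v => by simp only [Equiv.coe_addLeft]; congr)]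
            simp
          · simp [hz]
        simp [this]
      exact_mod_cast this.trans (sq _).symm
    have h1 : (S.card : ℝ) * w ≤ L ^ 2 * w ^ t * (U.card : ℝ) ^ 2 := by
      calc (S.card : ℝ) * w ≤ (∑ v, ((T v).card : ℝ)) * w := by
            gcongr
            exact_mod_cast hST
        _ = ∑ v, ((T v).card : ℝ) * w := Finset.sum_mul _ _ _
        _ ≤ ∑ v, L ^ 2 * ((V v).card : ℝ) * w ^ t := by
            refine Finset.sum_le_sum fun v _ => ih (L ^ 2) (sq_nonneg _) ?_ (V v) (T v)
              fun M hM => (Finset.mem_filter.1 hM).2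
            rwa [← pow_mul, ← pow_succ']
        _ = L ^ 2 * w ^ t * (U.card : ℝ) ^ 2 := by
            rw [← hV, Finset.mul_sum]
            exact Finset.sum_congr rfl fun v _ => by ring
    have h2 : (S.card : ℝ) ≤ w ^ (t + 1) := by
      have : S.card ≤ Fintype.card W ^ (t + 1) := (Finset.card_le_univ _).trans (by simp)
      rw [hw]
      exact_mod_cast this
    have hx : 0 ≤ L * U.card := by positivity
    rcases le_total (L * U.card) w with hle | hle
    · calc (S.card : ℝ) * w ≤ (L * U.card) * w ^ t * (L * U.card) := by linarith
        _ ≤ (L * U.card) * w ^ t * w := by gcongr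
        _ = L * U.card * w ^ (t + 1) := by ring
    · calc (S.card : ℝ) * w ≤ w ^ (t + 1) * (L * U.card) := by gcongr
        _ = L * U.card * w ^ (t + 1) := by ring

/-! ### The second moment -/

/-- The number `X α z` of codewords of `enc α` in `z + B` has mean `μ = |A||B| / |W|` over `z`, for
every `α`. The hypothesis `henc` bounds its variance over `(α, z)` by `μ`, so Chebyshev's inequality
bounds the density of the pairs with `X α z = 0` by `1 / μ`. -/
theorem sum_card_uncovered_mul_le {F A W : Type*} [Fintype F] [AddCommGroup A] [Fintype A]
    [AddCommGroup W] [Fintype W] (enc : F → A →+ W)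
    (henc : ∀ w, ∀ S : Finset (F × A), (∀ p ∈ S, p.2 ≠ 0 ∧ enc p.1 p.2 = w) →
      S.card * Fintype.card W ≤ Fintype.card F * Fintype.card A)
    (B : Finset W) (U : F → Finset W) (hU : ∀ α, ∀ z ∈ U α, ∀ x, enc α x - z ∉ B) :
    (∑ α, ((U α).card : ℝ)) * (Fintype.card A * B.card)
      ≤ Fintype.card F * (Fintype.card W : ℝ) ^ 2 := by
  classical
  set f : W → ℝ := fun w => if w ∈ B then 1 else 0 with hf
  have hf0 : ∀ w, 0 ≤ f w := fun w => by simp only [hf]; split_ifs <;> norm_num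
  have hff : ∀ w, f w * f w = f w := fun w => by simp only [hf]; split_ifs <;> norm_num
  have hfs : ∑ w, f w = B.card := by simp [hf]
  set I : W → ℝ := fun w => ∑ y, f y * f (w + y) with hI
  have hI0 : ∀ w, 0 ≤ I w := fun w => Finset.sum_nonneg fun y _ => mul_nonneg (hf0 _) (hf0 _)
  have hIz : I 0 = B.card := by simp [hI, hff, hfs]
  have hIs : ∑ w, I w = (B.card : ℝ) ^ 2 := by
    simp only [hI]
    rw [Finset.sum_comm]
    simp_rw [← Finset.mul_sum]
    have : ∀ y, ∑ w, f (w + y) = B.card := fun y => by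
      rw [← hfs]; exact Fintype.sum_equiv (Equiv.addRight y) _ _ fun w => rfl
    simp_rw [this, ← Finset.sum_mul, hfs, sq]
  set X : F → W → ℝ := fun α z => ∑ x, f (enc α x - z) with hX
  set w : ℝ := (Fintype.card W : ℝ) with hw
  have hw0 : 0 < w := by rw [hw]; exact_mod_cast Fintype.card_pos
  set n : ℝ := (Fintype.card A : ℝ) with hn
  set q : ℝ := (Fintype.card F : ℝ) with hq
  have hX1 : ∀ α, ∑ z, X α z = n * B.card := fun α => by
    simp only [hX]
    rw [Finset.sum_comm]
    have : ∀ x, ∑ z, f (enc α x - z) = B.card := fun x => by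
      rw [← hfs]; exact Fintype.sum_equiv (Equiv.subLeft (enc α x)) _ _ fun w => rfl
    simp [this, hn]
  have hX2 : ∀ α, ∑ z, X α z ^ 2 = n * ∑ x, I (enc α x) := fun α => by
    have h1 : ∀ x x', ∑ z, f (enc α x - z) * f (enc α x' - z) = I (enc α (x' - x)) := by
      intro x x'
      refine Fintype.sum_equiv (Equiv.subLeft (enc α x)) _ _ fun z => ?_
      simp only [Equiv.subLeft_apply, map_sub]
      congr 2
      abel
    have h2 : ∀ x, ∑ x', I (enc α (x' - x)) = ∑ x', I (enc α x') := fun x =>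
      Fintype.sum_equiv (Equiv.subRight x) _ _ fun z => rfl
    calc ∑ z, X α z ^ 2 = ∑ z, ∑ x, ∑ x', f (enc α x - z) * f (enc α x' - z) := by
          refine Finset.sum_congr rfl fun z _ => ?_
          rw [sq, hX, Finset.sum_mul_sum]
      _ = ∑ x, ∑ x', ∑ z, f (enc α x - z) * f (enc α x' - z) := by
          rw [Finset.sum_comm]
          exact Finset.sum_congr rfl fun x _ => Finset.sum_comm
      _ = n * ∑ x, I (enc α x) := by simp_rw [h1, h2]; simp [hn]
  have hpair : (∑ α, ∑ x, I (enc α x)) * w ≤ q * B.card * w + q * n * (B.card : ℝ) ^ 2 := by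
    have h1 : ∀ α, ∑ x, I (enc α x) = B.card + ∑ x, if x ≠ 0 then I (enc α x) else 0 := by
      intro α
      rw [← hIz, ← Finset.sum_filter, Finset.filter_ne', ← Finset.add_sum_erase _ _
        (Finset.mem_univ (0 : A)), map_zero]
    have h2 : ∑ α, ∑ x, (if x ≠ 0 then I (enc α x) else 0)
        = ∑ v, (Finset.card {p : F × A | p.2 ≠ 0 ∧ enc p.1 p.2 = v} : ℝ) * I v := by
      rw [← Fintype.sum_prod_type' (f := fun α x => if x ≠ 0 then I (enc α x) else 0),
        ← Finset.sum_filter, ← Finset.sum_fiberwise_of_maps_to (t := Finset.univ)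
        (g := fun p : F × A => enc p.1 p.2) (fun _ _ => Finset.mem_univ _)]
      refine Finset.sum_congr rfl fun v _ => ?_
      rw [Finset.filter_filter, Finset.sum_congr rfl (g := fun _ => I v)
        (fun p hp => by rw [(Finset.mem_filter.1 hp).2.2])]
      simp
    simp_rw [h1]
    rw [Finset.sum_add_distrib, h2, add_mul, Finset.sum_mul, Finset.sum_mul, ← hIs,
      Finset.mul_sum]
    refine add_le_add (by simp [hq, mul_assoc]) (Finset.sum_le_sum fun v _ => ?_)
    have : (Finset.card {p : F × A | p.2 ≠ 0 ∧ enc p.1 p.2 = v} : ℝ) * w ≤ q * n := by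
      rw [hw, hq, hn]; exact_mod_cast henc v _ fun p hp => (Finset.mem_filter.1 hp).2
    nlinarith [hI0 v]
  -- Chebyshev's inequality, with denominators cleared: the deviation is `w * X α z - n * |B|`.
  have hcheb : ∀ α, ((U α).card : ℝ) * (n * B.card) ^ 2
      ≤ ∑ z, (w * X α z - n * B.card) ^ 2 := fun α => by
    rw [← nsmul_eq_mul, ← Finset.sum_const]
    refine (Finset.sum_le_sum fun z hz => ?_).trans
      (Finset.sum_le_univ_sum_of_nonneg fun z => sq_nonneg _)
    have : X α z = 0 := Finset.sum_eq_zero fun x _ => by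
      simp [hf, hU α z hz x]
    rw [this]
    apply le_of_eq
    ring
  have hvar : ∀ α, ∑ z, (w * X α z - n * B.card) ^ 2
      = w ^ 2 * (n * ∑ x, I (enc α x)) - w * (n * B.card) ^ 2 := fun α => by
    have : ∀ z, (w * X α z - n * B.card) ^ 2
        = w ^ 2 * X α z ^ 2 - 2 * w * (n * B.card) * X α z + (n * B.card) ^ 2 := fun z => by ring
    simp_rw [this]
    rw [Finset.sum_add_distrib, Finset.sum_sub_distrib, ← Finset.mul_sum, ← Finset.mul_sum, hX1,
      hX2]
    simp only [Finset.sum_const, Finset.card_univ, nsmul_eq_mul, ← hw]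
    ring
  have hn0 : 0 < n := by rw [hn]; exact_mod_cast Fintype.card_pos
  have key : (∑ α, ((U α).card : ℝ)) * (n * B.card) ^ 2
      ≤ q * w ^ 2 * (n * B.card) := by
    calc _ ≤ ∑ α, (w ^ 2 * (n * ∑ x, I (enc α x)) - w * (n * B.card) ^ 2) := by
          rw [Finset.sum_mul]
          exact Finset.sum_le_sum fun α _ => (hcheb α).trans (hvar α).le
      _ = n * w * ((∑ α, ∑ x, I (enc α x)) * w) - q * (w * (n * B.card) ^ 2) := by
          rw [Finset.sum_sub_distrib, ← Finset.mul_sum, ← Finset.mul_sum]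
          simp only [Finset.sum_const, Finset.card_univ, nsmul_eq_mul, ← hq]
          ring
      _ ≤ n * w * (q * B.card * w + q * n * (B.card : ℝ) ^ 2) - q * (w * (n * B.card) ^ 2) := by
          gcongr
      _ = q * w ^ 2 * (n * B.card) := by ring
  rcases B.eq_empty_or_nonempty with rfl | hB
  · simp only [Finset.card_empty, Nat.cast_zero, mul_zero]
    positivity
  · have hB0 : (0 : ℝ) < B.card := by exact_mod_cast hB.card_pos
    refine le_of_mul_le_mul_right (le_trans (le_of_eq ?_) key) (mul_pos hn0 hB0)
    ring

/-! ### Wozencraft codes -/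

theorem vecMul_restrictedWozencraft_inl {a b : ℕ}
    (β : Module.Basis (Fin (max a b)) (ZMod 2) (GaloisField 2 (max a b)))
    (α : GaloisField 2 (max a b)) (x : Fin a → ZMod 2) (i : Fin a) :
    Matrix.vecMul x (restrictedWozencraft a b β α) (Sum.inl i) = x i := by
  simp [Matrix.vecMul, dotProduct, restrictedWozencraft, wozencraft, Matrix.one_apply]

theorem vecMul_restrictedWozencraft_inr {a b : ℕ}
    (β : Module.Basis (Fin (max a b)) (ZMod 2) (GaloisField 2 (max a b)))
    (α : GaloisField 2 (max a b)) (x : Fin a → ZMod 2) (j : Fin b) :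
    Matrix.vecMul x (restrictedWozencraft a b β α) (Sum.inr j)
      = β.repr (α * ∑ i, x i • β (Fin.castLE (le_max_left a b) i))
          (Fin.castLE (le_max_right a b) j) := by
  simp [Matrix.vecMul, dotProduct, restrictedWozencraft, wozencraft, mulMatrix, Finset.mul_sum]

/-- A word whose first `a` coordinates are not all zero is a codeword `x ↦ [x | α x]` for at most
a fraction `2 ^ (-b)` of all `α`: division by the field element with coordinates `x` determines the
product, of which `b` coordinates are prescribed. -/
theorem card_wozencraft_preimage_mul_le {a b : ℕ} [Fintype (GaloisField 2 (max a b))]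
    (β : Module.Basis (Fin (max a b)) (ZMod 2) (GaloisField 2 (max a b)))
    (w : Fin a ⊕ Fin b → ZMod 2) (S : Finset (GaloisField 2 (max a b) × (Fin a → ZMod 2)))
    (hS : ∀ p ∈ S, p.2 ≠ 0 ∧ Matrix.vecMul p.2 (restrictedWozencraft a b β p.1) = w) :
    S.card * Fintype.card (Fin a ⊕ Fin b → ZMod 2)
      ≤ Fintype.card (GaloisField 2 (max a b)) * Fintype.card (Fin a → ZMod 2) := by
  let ι : (Fin a → ZMod 2) → GaloisField 2 (max a b) := fun x =>
    ∑ i, x i • β (Fin.castLE (le_max_left a b) i)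
  have hι : ∀ x, x ≠ 0 → ι x ≠ 0 := fun x hx h0 => hx <| by
    have hli : LinearIndependent (ZMod 2) (fun i => β (Fin.castLE (le_max_left a b) i)) :=
      β.linearIndependent.comp _ (Fin.castLE_injective _)
    exact funext (Fintype.linearIndependent_iff.1 hli x h0)
  -- Moving the prescribed coordinates by `v` embeds `S × 𝔽₂ ^ b` into the field.
  let τ : (Fin b → ZMod 2) → GaloisField 2 (max a b) := fun v =>
    ∑ j, v j • β (Fin.castLE (le_max_right a b) j)
  have hτ : ∀ v j, β.repr (τ v) (Fin.castLE (le_max_right a b) j) = v j := fun v j => by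
    simp [τ, Finsupp.single_apply, Fin.ext_iff]
    simp [← Fin.ext_iff]
  have hle : (S ×ˢ (Finset.univ : Finset (Fin b → ZMod 2))).card
      ≤ Fintype.card (GaloisField 2 (max a b)) := by
    rw [← Finset.card_univ]
    refine Finset.card_le_card_of_injOn (fun p => p.1.1 * ι p.1.2 + τ p.2)
      (fun _ _ => Finset.mem_coe.2 (Finset.mem_univ _)) ?_
    rintro ⟨⟨α, x⟩, v⟩ h ⟨⟨α', x'⟩, v'⟩ h' heq
    replace h := hS _ (Finset.mem_product.1 (Finset.mem_coe.1 h)).1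
    replace h' := hS _ (Finset.mem_product.1 (Finset.mem_coe.1 h')).1
    simp only at h h' heq
    have hx : x = x' := funext fun i => by
      rw [← vecMul_restrictedWozencraft_inl β α x, ← vecMul_restrictedWozencraft_inl β α' x', h.2,
        h'.2]
    have hv : v = v' := funext fun j => by
      have h1 := congrArg (fun y => β.repr y (Fin.castLE (le_max_right a b) j)) heq
      simp only [map_add, Finsupp.add_apply, hτ] at h1
      have h2 := congrFun (h.2.trans h'.2.symm) (Sum.inr j)
      rw [vecMul_restrictedWozencraft_inr, vecMul_restrictedWozencraft_inr] at h2
      rw [show β.repr (α * ι x) _ = β.repr (α' * ι x') _ from h2] at h1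
      exact add_left_cancel h1
    subst hx hv
    have := mul_right_cancel₀ (hι x h.1) (add_right_cancel heq)
    rw [this]
  rw [Finset.card_product, Finset.card_univ] at hle
  calc S.card * Fintype.card (Fin a ⊕ Fin b → ZMod 2)
      = S.card * Fintype.card (Fin b → ZMod 2) * Fintype.card (Fin a → ZMod 2) := by
        simp [pow_add]; ring
    _ ≤ _ := Nat.mul_le_mul_right _ hle

/-! ### Covering radius and rate of direct sums -/

theorem exists_hammingDist_le_coveringRadius {X : Type*} [Fintype X]
    (C : Submodule (ZMod 2) (X → ZMod 2)) (z : X → ZMod 2) :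
    ∃ w ∈ C, hammingDist z w ≤ coveringRadius (C : Set (X → ZMod 2)) :=
  Nat.sInf_mem (s := {r : ℕ | ∀ z : X → ZMod 2, ∃ w ∈ (C : Set (X → ZMod 2)), hammingDist z w ≤ r})
    ⟨Fintype.card X, fun _ => ⟨0, C.zero_mem, hammingDist_le_card_fintype⟩⟩ z

theorem coveringRadius_le_card {X : Type*} [Fintype X] (C : Submodule (ZMod 2) (X → ZMod 2)) :
    coveringRadius (C : Set (X → ZMod 2)) ≤ Fintype.card X :=
  Nat.sInf_le fun _ => ⟨0, C.zero_mem, hammingDist_le_card_fintype⟩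

theorem coveringRadius_directSum_le {ι X : Type*} [Fintype ι] [Fintype X]
    (C : ι → Submodule (ZMod 2) (X → ZMod 2)) :
    coveringRadius (directSum C : Set (ι × X → ZMod 2))
      ≤ ∑ i, coveringRadius (C i : Set (X → ZMod 2)) := by
  refine Nat.sInf_le fun z => ?_
  choose w hw hd using fun i => exists_hammingDist_le_coveringRadius (C i) fun x => z (i, x)
  refine ⟨fun p => w p.1 p.2, hw, ?_⟩
  refine le_trans (le_of_eq ?_) (Finset.sum_le_sum fun i _ => hd i)
  simp only [hammingDist, Finset.card_filter, Fintype.sum_prod_type]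

theorem natCard_directSum {ι X : Type*} [Fintype ι]
    (C : ι → Submodule (ZMod 2) (X → ZMod 2)) :
    Nat.card (directSum C) = ∏ i, Nat.card (C i) := by
  rw [← Nat.card_pi]
  exact Nat.card_congr
    { toFun := fun w i => ⟨fun x => w.1 (i, x), w.2 i⟩
      invFun := fun w => ⟨fun p => (w p.1).1 p.2, fun i => (w i).2⟩
      left_inv := fun _ => rfl
      right_inv := fun _ => rfl }

theorem rate_directSum_mem_Icc {ι X : Type*} [Fintype ι] [Nonempty ι] [Fintype X] {k l : ℕ}
    (C : ι → Submodule (ZMod 2) (X → ZMod 2))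
    (hk : ∀ i, k ≤ Module.finrank (ZMod 2) (C i)) (hl : ∀ i, Module.finrank (ZMod 2) (C i) ≤ l) :
    rate (directSum C : Set (ι × X → ZMod 2))
      ∈ Set.Icc ((k : ℝ) / Fintype.card X) ((l : ℝ) / Fintype.card X) := by
  have h1 : ∀ i, Real.logb 2 (Nat.card (C i)) = Module.finrank (ZMod 2) (C i) := fun i => by
    rw [Module.natCard_eq_pow_finrank (K := ZMod 2)]
    push_cast
    rw [Nat.card_zmod, Real.logb_pow]
    simp
  have h2 : Real.logb 2 (Nat.card (directSum C)) = ∑ i, (Module.finrank (ZMod 2) (C i) : ℝ) := by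
    rw [natCard_directSum, Nat.cast_prod, Real.logb_prod]
    · exact Finset.sum_congr rfl fun i _ => h1 i
    · exact fun i _ => by simpa using Nat.card_pos.ne'
  have h3 : rate (directSum C : Set (ι × X → ZMod 2))
      = (∑ i, (Module.finrank (ZMod 2) (C i) : ℝ)) / Fintype.card ι / Fintype.card X := by
    rw [rate, Fintype.card_prod, Nat.cast_mul, ← div_div, ← h2]
    rfl
  have hι : (0 : ℝ) < Fintype.card ι := by exact_mod_cast Fintype.card_pos
  rw [h3]
  constructor
  · gcongr
    rw [le_div_iff₀ hι, mul_comm, ← nsmul_eq_mul, ← Finset.card_univ, ← Finset.sum_const]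
    exact Finset.sum_le_sum fun i _ => by exact_mod_cast hk i
  · gcongr
    rw [div_le_iff₀ hι, mul_comm, ← nsmul_eq_mul, ← Finset.card_univ, ← Finset.sum_const]
    exact Finset.sum_le_sum fun i _ => by exact_mod_cast hl i

theorem finrank_codeOf_generator_le {a b t : ℕ}
    (β : Module.Basis (Fin (max a b)) (ZMod 2) (GaloisField 2 (max a b))) (i : Index a b t) :
    Module.finrank (ZMod 2) (codeOf (generator β i)) ≤ a + t :=
  (finrank_range_le_card (R := ZMod 2) fun r => generator β i r).trans (by simp)

theorem vecMul_mem_codeOf_generator {a b t : ℕ}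
    (β : Module.Basis (Fin (max a b)) (ZMod 2) (GaloisField 2 (max a b))) (i : Index a b t)
    (x : Fin a → ZMod 2) :
    Matrix.vecMul x (restrictedWozencraft a b β i.1) ∈ codeOf (generator β i) := by
  rw [Matrix.vecMul_eq_sum]
  exact Submodule.sum_mem _ fun k _ =>
    Submodule.smul_mem _ _ (Submodule.subset_span ⟨Sum.inl k, rfl⟩)

theorem le_finrank_codeOf_generator {a b t : ℕ}
    (β : Module.Basis (Fin (max a b)) (ZMod 2) (GaloisField 2 (max a b))) (i : Index a b t) :
    a ≤ Module.finrank (ZMod 2) (codeOf (generator β i)) := by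
  let f : (Fin a → ZMod 2) →ₗ[ZMod 2] codeOf (generator β i) :=
    (Matrix.vecMulLinear (restrictedWozencraft a b β i.1)).codRestrict _
      (vecMul_mem_codeOf_generator β i)
  have hf : Function.Injective f := fun x y hxy => funext fun k => by
    have := congrFun (congrArg Subtype.val hxy) (Sum.inl k)
    rwa [← vecMul_restrictedWozencraft_inl β i.1 x, ← vecMul_restrictedWozencraft_inl β i.1 y]
  simpa using LinearMap.finrank_le_finrank_of_injective hf

theorem rate_construction_mem_Icc {a b : ℕ} (c : ℝ)
    (β : Module.Basis (Fin (max a b)) (ZMod 2) (GaloisField 2 (max a b))) :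
    rate (construction c a b β : Set (Coord c a b → ZMod 2))
      ∈ Set.Icc ((a : ℝ) / (a + b : ℕ)) ((a + numRows c a b : ℕ) / (a + b : ℕ) : ℝ) := by
  have := rate_directSum_mem_Icc
    (fun i : Index a b (numRows c a b) => codeOf (generator β i)) (le_finrank_codeOf_generator β)
    (finrank_codeOf_generator_le β)
  rwa [Fintype.card_sum, Fintype.card_fin, Fintype.card_fin] at this

/-! ### The covering radius of the construction -/

theorem choose_le_card_hammingNorm_le {X : Type*} [Fintype X] [DecidableEq X] (r : ℕ) :
    (Fintype.card X).choose r ≤ Finset.card {w : X → ZMod 2 | hammingNorm w ≤ r} := by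
  rw [← Finset.card_univ, ← Finset.card_powersetCard]
  refine Finset.card_le_card_of_injOn (fun s x => if x ∈ s then 1 else 0) (fun s hs => ?_) ?_
  · have := (Finset.mem_powersetCard.1 hs).2
    simp [hammingNorm, this]
  · intro s _ s' _ h
    ext x
    have := congrFun h x
    by_cases h1 : x ∈ s <;> by_cases h2 : x ∈ s' <;> simp_all

theorem card_index {a b t : ℕ} (ha : 0 < a) :
    Fintype.card (Index a b t) = 2 ^ max a b * (2 ^ (a + b)) ^ t := by
  rw [Fintype.card_eq_nat_card, Nat.card_prod,
    GaloisField.card 2 _ (ha.trans_le (le_max_left a b)).ne']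
  congr 1
  exact (Nat.card_eq_fintype_card (α := Fin t → Fin a ⊕ Fin b → ZMod 2)).trans (by simp)

theorem lt_hammingNorm_of_forall_lt_hammingDist {a b t r : ℕ}
    (β : Module.Basis (Fin (max a b)) (ZMod 2) (GaloisField 2 (max a b))) (i : Index a b t)
    {z : Fin a ⊕ Fin b → ZMod 2} (hz : ∀ w ∈ codeOf (generator β i), r < hammingDist z w)
    (c : Fin t → ZMod 2) (x : Fin a → ZMod 2) :
    r < hammingNorm
      (Matrix.vecMul x (restrictedWozencraft a b β i.1) - (z + ∑ k, c k • i.2 k)) := by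
  have hmem : Matrix.vecMul x (restrictedWozencraft a b β i.1) - ∑ k, c k • i.2 k
      ∈ codeOf (generator β i) :=
    Submodule.sub_mem _ (vecMul_mem_codeOf_generator β i x) <|
      Submodule.sum_mem _ fun k _ =>
        Submodule.smul_mem _ _ (Submodule.subset_span ⟨Sum.inr k, rfl⟩)
  have := hz _ hmem
  rw [hammingDist_eq_hammingNorm] at this
  rwa [show ∀ u v : Fin a ⊕ Fin b → ZMod 2, u - (z + v) = -z + (u - v) from fun u v => by abel]

/-- All but a fraction `4 * 2 ^ b / V` of the members of the ensemble have covering radius at most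
`r`, where `V` is the volume of a Hamming ball of radius `r`: the second moment shows that the
Wozencraft codes leave a fraction `2 ^ b / V` of all words uncovered on average, and the doubling
argument turns this density into a probability. -/
theorem card_not_covering_mul_le {a b t : ℕ} (ha : 0 < a)
    (β : Module.Basis (Fin (max a b)) (ZMod 2) (GaloisField 2 (max a b)))
    (ht : a + b ≤ 2 * 2 ^ t) (r : ℕ) (S : Finset (Index a b t))
    (hS : ∀ i ∈ S, ¬ ∀ z, ∃ w ∈ codeOf (generator β i), hammingDist z w ≤ r) :
    (S.card : ℝ) * Finset.card {w : Fin a ⊕ Fin b → ZMod 2 | hammingNorm w ≤ r}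
      ≤ 4 * 2 ^ b * Fintype.card (Index a b t) := by
  classical
  let _ : Fintype (GaloisField 2 (max a b)) := Fintype.ofFinite _
  set B : Finset (Fin a ⊕ Fin b → ZMod 2) := {w | hammingNorm w ≤ r} with hB
  let enc : GaloisField 2 (max a b) → (Fin a → ZMod 2) →+ (Fin a ⊕ Fin b → ZMod 2) := fun α =>
    (Matrix.vecMulLinear (restrictedWozencraft a b β α)).toAddMonoidHom
  let U : GaloisField 2 (max a b) → Finset (Fin a ⊕ Fin b → ZMod 2) := fun α =>
    {z | ∀ x, enc α x - z ∉ B}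
  let T : GaloisField 2 (max a b) → Finset (Fin t → Fin a ⊕ Fin b → ZMod 2) := fun α =>
    {M | ∃ z, ∀ c : Fin t → ZMod 2, z + ∑ i, c i • M i ∈ U α}
  have hST : S.card ≤ ∑ α, (T α).card := by
    rw [← Finset.card_sigma]
    refine Finset.card_le_card_of_injOn
      (fun i => (⟨i.1, i.2⟩ : Σ _ : GaloisField 2 (max a b), Fin t → Fin a ⊕ Fin b → ZMod 2)) ?_ ?_
    · rintro i hi
      have hi := hS i (Finset.mem_coe.1 hi)
      push Not at hi
      obtain ⟨z, hz⟩ := hi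
      refine Finset.mem_coe.2 (Finset.mem_sigma.2 ⟨Finset.mem_univ _, Finset.mem_filter.2
        ⟨Finset.mem_univ _, z, fun c => Finset.mem_filter.2 ⟨Finset.mem_univ _, fun x => ?_⟩⟩⟩)
      rw [hB, Finset.mem_filter, not_and, not_le]
      exact fun _ => lt_hammingNorm_of_forall_lt_hammingDist β i hz c x
    · rintro ⟨α, M⟩ _ ⟨α', M'⟩ _ h
      have h1 : α = α' := congrArg Sigma.fst h
      subst h1
      exact Prod.ext rfl (eq_of_heq (Sigma.mk.inj h).2)
  have hw : Fintype.card (Fin a ⊕ Fin b → ZMod 2) = 2 ^ (a + b) := by simp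
  have hA : Fintype.card (Fin a → ZMod 2) = 2 ^ a := by simp
  have hcov := sum_card_uncovered_mul_le enc
    (card_wozencraft_preimage_mul_le β) B U fun α z hz => (Finset.mem_filter.1 hz).2
  have hdbl : ∀ α, ((T α).card : ℝ) * 2 ^ (a + b) ≤ 4 * (U α).card * (2 ^ (a + b)) ^ t := by
    intro α
    have h4 : ((Fintype.card (Fin a ⊕ Fin b → ZMod 2) : ℕ) : ℝ) ≤ 4 ^ 2 ^ t := by
      rw [hw, show (4 : ℝ) = 2 ^ 2 by norm_num, ← pow_mul]
      push_cast
      exact pow_le_pow_right₀ (by norm_num) ht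
    have := card_exists_coset_subset_le t 4 (by norm_num) h4 (U α) (T α)
      fun M hM => (Finset.mem_filter.1 hM).2
    rw [hw] at this
    push_cast at this
    exact this
  rw [hw, hA, Fintype.card_eq_nat_card, GaloisField.card 2 _ (ha.trans_le (le_max_left a b)).ne']
    at hcov
  push_cast at hcov
  have hsum : (∑ α, ((T α).card : ℝ)) * 2 ^ (a + b)
      ≤ 4 * (∑ α, ((U α).card : ℝ)) * (2 ^ (a + b)) ^ t := by
    rw [Finset.sum_mul, Finset.mul_sum, Finset.sum_mul]
    exact Finset.sum_le_sum fun α _ => hdbl α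
  have hST' : (S.card : ℝ) ≤ ∑ α, ((T α).card : ℝ) := by exact_mod_cast hST
  rw [card_index ha]
  push_cast
  refine le_of_mul_le_mul_right (a := (2 : ℝ) ^ (a + b) * 2 ^ a) ?_ (by positivity)
  calc (S.card : ℝ) * B.card * (2 ^ (a + b) * 2 ^ a)
      ≤ (∑ α, ((T α).card : ℝ)) * B.card * (2 ^ (a + b) * 2 ^ a) := by gcongr
    _ = ((∑ α, ((T α).card : ℝ)) * 2 ^ (a + b)) * (2 ^ a * B.card) := by ring
    _ ≤ (4 * (∑ α, ((U α).card : ℝ)) * (2 ^ (a + b)) ^ t) * (2 ^ a * B.card) := by gcongr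
    _ = 4 * (2 ^ (a + b)) ^ t * ((∑ α, ((U α).card : ℝ)) * (2 ^ a * B.card)) := by ring
    _ ≤ 4 * (2 ^ (a + b)) ^ t * (2 ^ max a b * (2 ^ (a + b)) ^ 2) := by gcongr
    _ = 4 * 2 ^ b * (2 ^ max a b * (2 ^ (a + b)) ^ t) * (2 ^ (a + b) * 2 ^ a) := by ring

theorem le_two_pow_numRows_one {a b : ℕ} (ha : 0 < a) : max a b ≤ 2 ^ numRows 1 a b := by
  have hn : (0 : ℝ) < (max a b : ℕ) := by exact_mod_cast ha.trans_le (le_max_left a b)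
  have h : Real.logb 2 ((max a b : ℕ) : ℝ) ≤ numRows 1 a b := by
    simpa [numRows] using Nat.le_ceil (1 * Real.logb 2 ((max a b : ℕ) : ℝ))
  rw [Real.logb_le_iff_le_rpow (by norm_num) hn, Real.rpow_natCast] at h
  exact_mod_cast h

/-- The exceptional members of the ensemble have covering radius at most `a + b`, and they make up
at most a fraction `4 / (a + b)`, so they add at most `4` to the average covering radius. -/
theorem relCoveringRadius_construction_le {a b : ℕ} (ha : 0 < a)
    (β : Module.Basis (Fin (max a b)) (ZMod 2) (GaloisField 2 (max a b))) (r : ℕ)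
    (hr : (a + b) * 2 ^ b ≤ (a + b).choose r) :
    relCoveringRadius (construction 1 a b β : Set (Coord 1 a b → ZMod 2))
      ≤ ((r : ℝ) + 4) / (a + b : ℕ) := by
  classical
  set t := numRows 1 a b with ht
  have ht2 : a + b ≤ 2 * 2 ^ t := by
    have h1 := le_two_pow_numRows_one (b := b) ha
    rw [← ht] at h1
    have h2 := le_max_left a b
    have h3 := le_max_right a b
    omega
  set S : Finset (Index a b t) :=
    {i | ¬ ∀ z, ∃ w ∈ codeOf (generator β i), hammingDist z w ≤ r} with hS
  have hbad := card_not_covering_mul_le ha β ht2 r S fun i hi => (Finset.mem_filter.1 hi).2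
  have hm : (0 : ℝ) < (a + b : ℕ) := by exact_mod_cast Nat.add_pos_left ha b
  have hV : ((a + b : ℕ) : ℝ) * 2 ^ b
      ≤ Finset.card {w : Fin a ⊕ Fin b → ZMod 2 | hammingNorm w ≤ r} := by
    have := choose_le_card_hammingNorm_le (X := Fin a ⊕ Fin b) r
    rw [Fintype.card_sum, Fintype.card_fin, Fintype.card_fin] at this
    exact_mod_cast hr.trans this
  have hSm : (S.card : ℝ) * (a + b : ℕ) ≤ 4 * Fintype.card (Index a b t) := by
    refine le_of_mul_le_mul_right (a := (2 : ℝ) ^ b) ?_ (by positivity)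
    calc (S.card : ℝ) * (a + b : ℕ) * 2 ^ b = S.card * ((a + b : ℕ) * 2 ^ b) := by ring
      _ ≤ _ := by gcongr
      _ ≤ _ := hbad
      _ = _ := by ring
  have hrad : ∀ i : Index a b t,
      coveringRadius (codeOf (generator β i) : Set (Fin a ⊕ Fin b → ZMod 2))
        ≤ r + if i ∈ S then a + b else 0 := fun i => by
    split_ifs with hi
    · refine (coveringRadius_le_card _).trans ?_
      rw [Fintype.card_sum, Fintype.card_fin, Fintype.card_fin]
      exact Nat.le_add_left _ _
    · simp only [hS, Finset.mem_filter, Finset.mem_univ, true_and, not_not] at hi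
      exact Nat.sInf_le hi
  have htot : (coveringRadius (construction 1 a b β : Set (Coord 1 a b → ZMod 2)) : ℝ)
      ≤ Fintype.card (Index a b t) * r + S.card * (a + b : ℕ) := by
    have : coveringRadius (construction 1 a b β : Set (Coord 1 a b → ZMod 2))
        ≤ Fintype.card (Index a b t) * r + S.card * (a + b) := by
      refine (coveringRadius_directSum_le _).trans
        ((Finset.sum_le_sum fun i _ => hrad i).trans (le_of_eq ?_))
      simp [Finset.sum_add_distrib]
    exact_mod_cast this
  have hI : (0 : ℝ) < Fintype.card (Index a b t) := by exact_mod_cast Fintype.card_pos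
  have hcard : Fintype.card (Coord 1 a b) = Fintype.card (Index a b t) * (a + b) := by
    rw [Fintype.card_prod, Fintype.card_sum, Fintype.card_fin, Fintype.card_fin]
  rw [relCoveringRadius, hcard, Nat.cast_mul, div_le_div_iff₀ (by positivity) hm]
  calc _ ≤ (Fintype.card (Index a b t) * r + 4 * Fintype.card (Index a b t) : ℝ) * (a + b : ℕ) := by
        gcongr
        exact htot.trans (by gcongr)
    _ = _ := by ring

/-! ### Binomial coefficients and entropy -/

theorem factorial_mul_pow_le (k j : ℕ) :
    k.factorial * k ^ j ≤ j.factorial * k ^ k := by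
  rcases le_total k j with h | h
  · calc k.factorial * k ^ j = k.factorial * k ^ (j - k) * k ^ k := by
          rw [mul_assoc, ← pow_add, Nat.sub_add_cancel h]
      _ ≤ _ := Nat.mul_le_mul_right _ (Nat.factorial_mul_pow_sub_le_factorial h)
  · have h1 := Nat.factorial_mul_descFactorial (Nat.sub_le k j)
    rw [Nat.sub_sub_self h] at h1
    calc k.factorial * k ^ j = j.factorial * (k.descFactorial (k - j) * k ^ j) := by
          rw [← h1, mul_assoc]
      _ ≤ j.factorial * (k ^ (k - j) * k ^ j) := by
          gcongr
          exact Nat.descFactorial_le_pow _ _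
      _ = _ := by rw [← pow_add, Nat.sub_add_cancel h]

/-- The largest of the `k + l + 1` terms of the binomial expansion of `(k + l) ^ (k + l)` is the one
with index `k`. -/
theorem add_pow_add_le_choose (k l : ℕ) :
    (k + l) ^ (k + l) ≤ (k + l + 1) * ((k + l).choose k * (k ^ k * l ^ l)) := by
  rw [add_pow k l (k + l)]
  refine (Finset.sum_le_card_nsmul _ _ ((k + l).choose k * (k ^ k * l ^ l)) ?_).trans
    (by simp)
  intro j hj
  obtain ⟨i, hi⟩ := Nat.exists_eq_add_of_le (Nat.lt_succ_iff.1 (Finset.mem_range.1 hj))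
  have hij : k + l - j = i := by omega
  rw [hij]
  -- After division by `(k + l)!`, the terms compare factor by factor.
  have hpos : 0 < k.factorial * l.factorial * (j.factorial * i.factorial) := by positivity
  refine Nat.le_of_mul_le_mul_right ?_ hpos
  have h1 : (k + l).choose j * (j.factorial * i.factorial) = (k + l).factorial := by
    rw [← mul_assoc, ← hij, Nat.choose_mul_factorial_mul_factorial (by omega)]
  have h2 : (k + l).choose k * (k.factorial * l.factorial) = (k + l).factorial := by
    rw [← mul_assoc, ← Nat.choose_mul_factorial_mul_factorial (Nat.le_add_right k l),
      Nat.add_sub_cancel_left]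
  calc k ^ j * l ^ i * (k + l).choose j * (k.factorial * l.factorial * (j.factorial * i.factorial))
      = ((k + l).choose j * (j.factorial * i.factorial))
        * ((k.factorial * k ^ j) * (l.factorial * l ^ i)) := by ring
    _ ≤ (k + l).factorial * ((j.factorial * k ^ k) * (i.factorial * l ^ l)) := by
        rw [h1]
        exact Nat.mul_le_mul_left _
          (Nat.mul_le_mul (factorial_mul_pow_le k j) (factorial_mul_pow_le l i))
    _ = _ := by rw [← h2]; ring

theorem two_rpow_mul_entropy_le_choose {m k : ℕ} (hk : 0 < k) (hkm : k < m) :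
    (2 : ℝ) ^ ((m : ℝ) * entropy (k / m)) ≤ (m + 1) * m.choose k := by
  obtain ⟨l, rfl⟩ := Nat.exists_eq_add_of_lt hkm
  rw [add_assoc]
  generalize hl' : l + 1 = l'
  have hl : 0 < l' := by omega
  have hk0 : (0 : ℝ) < k := by exact_mod_cast hk
  have hl0 : (0 : ℝ) < l' := by exact_mod_cast hl
  have hlog2 : Real.log 2 ≠ 0 := (Real.log_pos (by norm_num)).ne'
  have h := add_pow_add_le_choose k l'
  have hR : ((k : ℝ) + l') ^ (k + l')
      ≤ (k + l' + 1) * ((k + l').choose k * ((k : ℝ) ^ k * (l' : ℝ) ^ l')) := by exact_mod_cast h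
  have hone : 1 - (k : ℝ) / (k + l') = l' / (k + l') := by field_simp; ring
  have hexp : (2 : ℝ) ^ (((k + l' : ℕ) : ℝ) * entropy (k / (k + l' : ℕ)))
      = ((k : ℝ) + l') ^ (k + l') / ((k : ℝ) ^ k * (l' : ℝ) ^ l') := by
    rw [Real.rpow_def_of_pos (by norm_num), ← Real.exp_log (by positivity :
      (0 : ℝ) < ((k : ℝ) + l') ^ (k + l') / ((k : ℝ) ^ k * (l' : ℝ) ^ l'))]
    congr 1
    rw [Real.log_div (by positivity) (by positivity), Real.log_mul (by positivity) (by positivity),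
      Real.log_pow, Real.log_pow, Real.log_pow, entropy, Real.binEntropy]
    push_cast
    rw [hone, inv_div, inv_div, Real.log_div (by positivity) (by positivity),
      Real.log_div (by positivity) (by positivity)]
    field_simp
    ring
  rw [hexp, div_le_iff₀ (by positivity)]
  push_cast
  linarith

/-- The graph of the entropy lies above the chord from `(δ, H(δ))` to `(1/2, 1)`. -/
theorem entropy_chord_le {δ x : ℝ} (hδ : 0 < δ) (hδ2 : δ < 1 / 2) (hx : δ ≤ x) (hx2 : x ≤ 1 / 2) :
    entropy δ + (1 - entropy δ) / (1 / 2 - δ) * (x - δ) ≤ entropy x := by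
  have hlog2 : 0 < Real.log 2 := Real.log_pos (by norm_num)
  obtain ⟨d, rfl⟩ : ∃ d, δ = 1 / 2 - d := ⟨1 / 2 - δ, by ring⟩
  have hd : 0 < d := by linarith
  rw [sub_sub_cancel]
  have hc := Real.strictConcave_binEntropy.concaveOn.2
    (⟨hδ.le, by linarith⟩ : (1 / 2 - d) ∈ Set.Icc (0 : ℝ) 1)
    (⟨by norm_num, by norm_num⟩ : (1 / 2 : ℝ) ∈ Set.Icc (0 : ℝ) 1)
    (div_nonneg (by linarith) hd.le : 0 ≤ (1 / 2 - x) / d)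
    (div_nonneg (by linarith) hd.le : 0 ≤ (x - (1 / 2 - d)) / d) (by field_simp; ring)
  have hx' : ((1 / 2 - x) / d) • (1 / 2 - d) + ((x - (1 / 2 - d)) / d) • (1 / 2 : ℝ) = x := by
    simp only [smul_eq_mul]
    field_simp
    ring
  rw [hx', show (1 / 2 : ℝ) = 2⁻¹ by norm_num, Real.binEntropy_two_inv, ← one_div, smul_eq_mul,
    smul_eq_mul] at hc
  rw [entropy, entropy, le_div_iff₀ hlog2]
  refine le_trans (le_of_eq ?_) hc
  field_simp
  ring

theorem entropy_pos {δ : ℝ} (hδ : 0 < δ) (hδ2 : δ < 1 / 2) : 0 < entropy δ :=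
  div_pos (Real.binEntropy_pos hδ (by linarith)) (Real.log_pos (by norm_num))

theorem entropy_lt_one {δ : ℝ} (hδ2 : δ < 1 / 2) : entropy δ < 1 := by
  rw [entropy, div_lt_one (Real.log_pos (by norm_num)), Real.binEntropy_lt_log_two]
  norm_num at hδ2 ⊢
  exact hδ2.ne

/-- The radius `δ m + x`, where `x ≥ 0` pays for a redundancy `b` above
`m H(δ) - 2 log₂ (m + 1)` at the rate given by the slope of the chord of the entropy. -/
theorem relCoveringRadius_construction_le_add {δ x : ℝ} (hδ : 0 < δ) (hδ2 : δ < 1 / 2)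
    (hx : 0 ≤ x) {m a b : ℕ} (ha : 0 < a) (hm : a + b = m)
    (hb : (b : ℝ) + 2 * Real.logb 2 (m + 1)
      ≤ m * entropy δ + (1 - entropy δ) / (1 / 2 - δ) * x)
    (hxm : δ * m + x + 1 ≤ m / 2)
    (β : Module.Basis (Fin (max a b)) (ZMod 2) (GaloisField 2 (max a b))) :
    relCoveringRadius (construction 1 a b β : Set (Coord 1 a b → ZMod 2)) ≤ δ + (x + 5) / m := by
  subst hm
  set m := a + b with hm
  have hm0 : (0 : ℝ) < m := by exact_mod_cast Nat.add_pos_left ha b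
  set r := ⌈δ * m + x⌉₊ with hr
  have hpos : 0 < δ * m + x := by positivity
  have hr1 : δ * m + x ≤ r := Nat.le_ceil _
  have hr2 : (r : ℝ) < δ * m + x + 1 := Nat.ceil_lt_add_one hpos.le
  have hr0 : 0 < r := Nat.ceil_pos.2 hpos
  have hrm : r < m := by
    have : (r : ℝ) < m := by linarith
    exact_mod_cast this
  have hκ : 0 ≤ (1 - entropy δ) / (1 / 2 - δ) :=
    div_nonneg (by linarith [entropy_lt_one hδ2]) (by linarith)
  have hH : m * entropy δ + (1 - entropy δ) / (1 / 2 - δ) * x ≤ m * entropy (r / m) := by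
    have h1 : δ + x / m ≤ r / m := by
      rw [le_div_iff₀ hm0, add_mul, div_mul_cancel₀ _ hm0.ne']
      exact hr1
    have hx' : 0 ≤ x / m := by positivity
    have h2 : (r : ℝ) / m ≤ 1 / 2 := by
      rw [div_le_iff₀ hm0]
      linarith
    have h3 := entropy_chord_le hδ hδ2 (by linarith) h2
    have h4 : (1 - entropy δ) / (1 / 2 - δ) * (x / m)
        ≤ (1 - entropy δ) / (1 / 2 - δ) * (r / m - δ) := by
      gcongr
      linarith
    calc _ = m * (entropy δ + (1 - entropy δ) / (1 / 2 - δ) * (x / m)) := by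
          field_simp
      _ ≤ m * entropy (r / m) := by
          gcongr
          linarith
  have hch := two_rpow_mul_entropy_le_choose hr0 hrm
  have hle : (m : ℝ) * 2 ^ b ≤ m.choose r := by
    have h1 : (2 : ℝ) ^ b * (m + 1) ^ 2 ≤ (m + 1) * m.choose r := by
      refine le_trans (le_of_eq ?_)
        ((Real.rpow_le_rpow_of_exponent_le (by norm_num) (hb.trans hH)).trans hch)
      rw [Real.rpow_add (by norm_num), Real.rpow_natCast, mul_comm 2 (Real.logb _ _),
        Real.rpow_mul (by norm_num), Real.rpow_logb (by norm_num) (by norm_num) (by positivity)]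
      norm_num
    have h2 : (2 : ℝ) ^ b * (m + 1) ≤ m.choose r := by
      refine le_of_mul_le_mul_right (a := (m : ℝ) + 1) ?_ (by positivity)
      linarith
    linarith [pow_pos (two_pos : (0 : ℝ) < 2) b]
  refine (relCoveringRadius_construction_le ha β r (by exact_mod_cast hle)).trans ?_
  rw [← hm, div_le_iff₀ hm0, add_mul, div_mul_cancel₀ _ hm0.ne']
  linarith

/-! ### The parameters in terms of `m = a + b` -/

theorem two_mul_logb_add_one_le {m : ℕ} (hm : 1 ≤ Real.log m) :
    2 * Real.logb 2 ((m : ℝ) + 1) ≤ 5 * Real.log m := by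
  have hm1 : (1 : ℝ) ≤ m := by
    rcases Nat.eq_zero_or_pos m with rfl | h
    · norm_num at hm
    · exact_mod_cast h
  have hl : 0.69 < Real.log 2 := by linarith [Real.log_two_gt_d9]
  have h : Real.log (m + 1) ≤ Real.log 2 + Real.log m := by
    rw [← Real.log_mul (by norm_num) (by positivity)]
    exact Real.log_le_log (by positivity) (by linarith)
  rw [Real.logb, mul_div_assoc', div_le_iff₀ (by linarith)]
  nlinarith

theorem numRows_one_le {a b m : ℕ} (ha : 0 < a) (hab : a + b = m) (hm : 1 ≤ Real.log m) :
    (numRows 1 a b : ℝ) ≤ 3 * Real.log m := by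
  have hn : (1 : ℝ) ≤ (max a b : ℕ) := by exact_mod_cast Nat.le_trans ha (le_max_left a b)
  have hnm : ((max a b : ℕ) : ℝ) ≤ m := by exact_mod_cast max_le (by omega) (by omega)
  have hl : 0.69 < Real.log 2 := by linarith [Real.log_two_gt_d9]
  have h1 : (numRows 1 a b : ℝ) < 1 * Real.logb 2 ((max a b : ℕ) : ℝ) + 1 :=
    Nat.ceil_lt_add_one (by rw [one_mul]; exact Real.logb_nonneg (by norm_num) hn)
  have h2 : Real.logb 2 ((max a b : ℕ) : ℝ) ≤ 2 * Real.log m := by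
    rw [Real.logb, div_le_iff₀ (by linarith)]
    have := Real.log_le_log (by linarith) hnm
    nlinarith
  linarith

theorem blockLength_one_eq {a b : ℕ} (ha : 0 < a) :
    blockLength 1 a b = 2 ^ max a b * (2 ^ (a + b)) ^ numRows 1 a b * (a + b) := by
  rw [blockLength, Fintype.card_prod, card_index ha, Fintype.card_sum, Fintype.card_fin,
    Fintype.card_fin]

theorem log_blockLength_le {a b m : ℕ} (ha : 0 < a) (hab : a + b = m) (hm : 1 ≤ Real.log m) :
    Real.log (blockLength 1 a b) ≤ 5 * (m * Real.log m) := by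
  have ht := numRows_one_le ha hab hm
  have hm1 : (1 : ℝ) ≤ m := by exact_mod_cast (by omega : 1 ≤ m)
  have hnm : ((max a b : ℕ) : ℝ) ≤ m := by exact_mod_cast max_le (by omega) (by omega)
  rw [blockLength_one_eq ha, hab]
  push_cast
  rw [Real.log_mul (by positivity) (by positivity), Real.log_mul (by positivity) (by positivity),
    ← pow_mul, Real.log_pow, Real.log_pow]
  push_cast at hnm ⊢
  have hl0 : 0 < Real.log 2 := Real.log_pos (by norm_num)
  have hl1 : Real.log 2 ≤ 1 := by linarith [Real.log_two_lt_d9]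
  have h1 : max (a : ℝ) b * Real.log 2 ≤ m * Real.log m :=
    mul_le_mul hnm (hl1.trans hm) hl0.le (by positivity)
  have h2 : (m : ℝ) * numRows 1 a b * Real.log 2 ≤ m * (3 * Real.log m) * 1 := by gcongr
  have h3 : 1 * Real.log m ≤ m * Real.log m := by gcongr
  linarith

theorem le_log_blockLength {a b m : ℕ} (ha : 0 < a) (hab : a + b = m) (hm : 6 ≤ m) :
    (m : ℝ) ≤ Real.log (blockLength 1 a b) := by
  have h3 : 3 ^ m ≤ blockLength 1 a b := by
    have hn : 3 ≤ max a b := by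
      have h1 := le_max_left a b
      have h2 := le_max_right a b
      omega
    rw [blockLength_one_eq ha, hab, ← pow_mul, mul_comm m, pow_mul]
    calc 3 ^ m ≤ (2 ^ numRows 1 a b) ^ m := by
          gcongr
          exact hn.trans (le_two_pow_numRows_one ha)
      _ = 1 * (2 ^ numRows 1 a b) ^ m * 1 := by ring
      _ ≤ _ := by
          gcongr
          · exact Nat.one_le_two_pow
          · omega
  have h1 : (1 : ℝ) ≤ Real.log 3 := by
    rw [Real.le_log_iff_exp_le (by norm_num)]
    exact Real.exp_one_lt_three.le
  calc (m : ℝ) = m * 1 := (mul_one _).symm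
    _ ≤ m * Real.log 3 := by gcongr
    _ = Real.log ((3 : ℝ) ^ m) := (Real.log_pow _ _).symm
    _ ≤ _ := Real.log_le_log (by positivity) (by exact_mod_cast h3)

theorem exists_forall_mul_log_le (K : ℝ) :
    ∃ m₀ : ℕ, ∀ m : ℕ, m₀ ≤ m → 6 ≤ m ∧ 1 ≤ Real.log m ∧ K * Real.log m ≤ m := by
  have h1 : ∀ᶠ m : ℕ in Filter.atTop, 1 ≤ Real.log m :=
    (Real.tendsto_log_atTop.comp tendsto_natCast_atTop_atTop).eventually_ge_atTop 1
  have h2 : ∀ᶠ m : ℕ in Filter.atTop, ‖Real.log (m : ℝ)‖ ≤ (|K| + 1)⁻¹ * ‖(m : ℝ)‖ :=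
    tendsto_natCast_atTop_atTop.eventually
      (Real.isLittleO_log_id_atTop.bound (by positivity : 0 < (|K| + 1)⁻¹))
  obtain ⟨m₀, h⟩ := Filter.eventually_atTop.1 (h1.and (h2.and (Filter.eventually_ge_atTop 6)))
  refine ⟨m₀, fun m hm => ⟨(h m hm).2.2, (h m hm).1, ?_⟩⟩
  obtain ⟨h1, h2, -⟩ := h m hm
  rw [Real.norm_of_nonneg (by linarith), Real.norm_of_nonneg (Nat.cast_nonneg m),
    inv_mul_eq_div, le_div_iff₀ (by positivity)] at h2
  nlinarith [le_abs_self K]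

/-- A redundancy `b` of at most `m H(δ) + 4 log m` costs `O_δ(log m / m)` in the relative covering
radius. -/
theorem relCoveringRadius_construction_le_log {δ : ℝ} (hδ : 0 < δ) (hδ2 : δ < 1 / 2) {m a b : ℕ}
    (ha : 0 < a) (hab : a + b = m) (hm : 1 ≤ Real.log m)
    (hb : (b : ℝ) ≤ m * entropy δ + 4 * Real.log m)
    (hlog : (9 * (1 / 2 - δ) / (1 - entropy δ) + 1) * Real.log m ≤ (1 / 2 - δ) * m)
    (β : Module.Basis (Fin (max a b)) (ZMod 2) (GaloisField 2 (max a b))) :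
    relCoveringRadius (construction 1 a b β : Set (Coord 1 a b → ZMod 2))
      ≤ δ + (9 * (1 / 2 - δ) / (1 - entropy δ) + 5) * (Real.log m / m) := by
  have hH : 0 < 1 - entropy δ := by linarith [entropy_lt_one hδ2]
  have hd : 0 < 1 / 2 - δ := by linarith
  set D := 9 * (1 / 2 - δ) / (1 - entropy δ) with hD
  have hD0 : 0 ≤ D := by positivity
  have hslope : (1 - entropy δ) / (1 / 2 - δ) * (D * Real.log m) = 9 * Real.log m := by
    have hd' : 1 - 2 * δ ≠ 0 := ne_of_gt (by linarith)
    rw [hD]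
    field_simp
  refine (relCoveringRadius_construction_le_add hδ hδ2 (x := D * Real.log m) (by positivity) ha hab
    ?_ (by linarith) β).trans ?_
  · rw [hslope]
    linarith [two_mul_logb_add_one_le hm]
  · rw [mul_div_assoc']
    gcongr
    linarith

/-- The radius is at most `δ + 5 / m` for `m` of order `1 / ε`; the redundancy is kept `O(log m)`
below `m H(δ)`, which costs `O(ε log (1 / ε))` in the rate. -/
theorem exists_construction_excess_rate {δ : ℝ} (hδ : 0 < δ) (hδ2 : δ < 1 / 2) :
    ∃ C₀ : ℝ, ∀ C : ℝ, C₀ ≤ C → ∀ ε : ℝ, 0 < ε → ε ≤ 1 / 2 → ∃ a b : ℕ, 0 < a ∧ 0 < b ∧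
      (blockLength 1 a b : ℝ) ≤ Real.exp (C * ((1 / ε) * Real.log (1 / ε))) ∧
      ∀ β : Module.Basis (Fin (max a b)) (ZMod 2) (GaloisField 2 (max a b)),
        relCoveringRadius (construction 1 a b β : Set (Coord 1 a b → ZMod 2)) ≤ δ + ε ∧
        |rate (construction 1 a b β : Set (Coord 1 a b → ZMod 2)) - (1 - entropy δ)|
          ≤ C * (ε * Real.log (1 / ε)) := by
  have hH0 := entropy_pos hδ hδ2
  have hH1 := entropy_lt_one hδ2
  set h := entropy δ with hh
  have hd : 0 < 1 / 2 - δ := by linarith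
  obtain ⟨m₀, hm₀⟩ := exists_forall_mul_log_le (6 / h + 1 / (1 / 2 - δ))
  set K : ℝ := m₀ + 5 with hK
  have hm₀0 : (0 : ℝ) ≤ m₀ := Nat.cast_nonneg _
  have hK0 : 0 < K := by positivity
  have hlogK : 0 ≤ Real.log (2 * K) := Real.log_nonneg (by linarith)
  set K' : ℝ := 2 * Real.log (2 * K) + 1 with hK'
  have hK'0 : 0 < K' := by positivity
  -- `log m ≤ K' log (1 / ε)` and `log m / m ≤ (K' / K) ε log (1 / ε)` for `m = ⌈K / ε⌉`; the loss
  -- in the rate is at most `9 log m / m`.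
  refine ⟨10 * K * K' + 9 * K' / K, fun C hC ε hε hε2 => ?_⟩
  have hC1 : 10 * K * K' ≤ C := le_trans (le_add_of_nonneg_right (by positivity)) hC
  have hC2 : 9 * K' / K ≤ C := le_trans (le_add_of_nonneg_left (by positivity)) hC
  have hε1 : 2 ≤ 1 / ε := by rw [le_div_iff₀ hε]; linarith
  set Λ := Real.log (1 / ε) with hΛ
  have hΛ1 : 1 / 2 ≤ Λ := by
    have := Real.log_le_log (by norm_num) hε1
    linarith [Real.log_two_gt_d9]
  set m := ⌈K / ε⌉₊ with hm
  have hmK : K / ε ≤ m := Nat.le_ceil _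
  have hKε : 2 * K ≤ K / ε := by
    calc 2 * K ≤ (1 / ε) * K := by gcongr
      _ = K / ε := by ring
  have hmm : (m : ℝ) ≤ 2 * K * (1 / ε) := by
    have h1 : (m : ℝ) < K / ε + 1 := Nat.ceil_lt_add_one (by positivity)
    have h2 : 2 * K * (1 / ε) = 2 * (K / ε) := by ring
    linarith
  obtain ⟨hm6, hlog1, hlog⟩ := hm₀ m (by
    have : (m₀ : ℝ) ≤ m := by linarith
    exact_mod_cast this)
  have hmpos : (0 : ℝ) < m := by linarith
  have hlogm : Real.log m ≤ K' * Λ := by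
    have h1 := Real.log_le_log hmpos hmm
    rw [Real.log_mul (by positivity) (by positivity)] at h1
    nlinarith
  have hlogdiv : Real.log m / m ≤ K' / K * (ε * Λ) := by
    calc Real.log m / m ≤ K' * Λ / (K / ε) := by gcongr
      _ = K' / K * (ε * Λ) := by field_simp
  rw [add_mul] at hlog
  have hlogh : 6 * Real.log m ≤ h * m := by
    have h1 : 6 / h * Real.log m ≤ m :=
      le_trans (le_add_of_nonneg_right (by positivity)) hlog
    rw [div_mul_eq_mul_div, div_le_iff₀ hH0] at h1
    linarith
  have hlogd : Real.log m ≤ (1 / 2 - δ) * m := by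
    have h1 : 1 / (1 / 2 - δ) * Real.log m ≤ m :=
      le_trans (le_add_of_nonneg_left (by positivity)) hlog
    rw [div_mul_eq_mul_div, div_le_iff₀ hd] at h1
    linarith
  set b := ⌊m * h - 5 * Real.log m⌋₊ with hb
  have hb0 : 0 < b := Nat.floor_pos.2 (by linarith)
  have hb1 : (b : ℝ) ≤ m * h - 5 * Real.log m := Nat.floor_le (by linarith)
  have hb2 : m * h - 5 * Real.log m < b + 1 := Nat.lt_floor_add_one _
  have hbm : b < m := by
    have : (b : ℝ) < m := by nlinarith
    exact_mod_cast this
  obtain ⟨a, hab⟩ : ∃ a, a + b = m := ⟨m - b, by omega⟩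
  have ha : 0 < a := by omega
  have habR : (a : ℝ) + b = m := by exact_mod_cast hab
  refine ⟨a, b, ha, hb0, ?_, fun β => ⟨?_, ?_⟩⟩
  · rw [← Real.log_le_iff_le_exp (by rw [blockLength_one_eq ha]; positivity)]
    calc _ ≤ 5 * (m * Real.log m) := log_blockLength_le ha hab hlog1
      _ ≤ 5 * ((2 * K * (1 / ε)) * (K' * Λ)) := by gcongr
      _ = 10 * K * K' * (1 / ε * Λ) := by ring
      _ ≤ C * (1 / ε * Λ) := by gcongr
  · refine (relCoveringRadius_construction_le_add hδ hδ2 le_rfl ha hab ?_ (by linarith) β).trans ?_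
    · linarith [two_mul_logb_add_one_le hlog1]
    · gcongr
      rw [div_le_iff₀ hmpos]
      have : 5 ≤ ε * (K / ε) := by rw [mul_div_cancel₀ _ hε.ne']; linarith
      nlinarith
  · have hr := rate_construction_mem_Icc 1 β
    rw [hab] at hr
    push_cast at hr
    have ht := numRows_one_le ha hab hlog1
    have h1 : 1 - h ≤ a / m := by
      rw [le_div_iff₀ hmpos]
      linarith
    have h2 : ((a : ℝ) + numRows 1 a b) / m ≤ 1 - h + 9 * (Real.log m / m) := by
      rw [div_le_iff₀ hmpos, add_mul, mul_assoc, div_mul_cancel₀ _ hmpos.ne']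
      linarith
    rw [abs_of_nonneg (by linarith [hr.1])]
    calc _ ≤ 9 * (Real.log m / m) := by linarith [hr.2]
      _ ≤ 9 * (K' / K * (ε * Λ)) := by gcongr
      _ = 9 * K' / K * (ε * Λ) := by ring
      _ ≤ C * (ε * Λ) := by gcongr

/-- The dimension is kept `O(log m)` below `(1 - H(δ)) m`, so that the `t` additional rows do not
raise the rate above `1 - H(δ)`; then `log m / m` is at most `ε` for `m` of order
`(1 / ε) log (1 / ε)`. -/
theorem exists_construction_rate_le {δ : ℝ} (hδ : 0 < δ) (hδ2 : δ < 1 / 2) :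
    ∃ C₀ : ℝ, ∀ C : ℝ, C₀ ≤ C → ∀ ε : ℝ, 0 < ε → ε ≤ 1 / 2 → ∃ a b : ℕ, 0 < a ∧ 0 < b ∧
      (blockLength 1 a b : ℝ) ≤ Real.exp (C * ((1 / ε) * Real.log (1 / ε) ^ 2)) ∧
      ∀ β : Module.Basis (Fin (max a b)) (ZMod 2) (GaloisField 2 (max a b)),
        relCoveringRadius (construction 1 a b β : Set (Coord 1 a b → ZMod 2)) ≤ δ + ε ∧
        rate (construction 1 a b β : Set (Coord 1 a b → ZMod 2)) ≤ 1 - entropy δ ∧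
        1 - entropy δ - C * ε ≤ rate (construction 1 a b β : Set (Coord 1 a b → ZMod 2)) := by
  have hH1 : 0 < 1 - entropy δ := by linarith [entropy_lt_one hδ2]
  have hH0 := entropy_pos hδ hδ2
  set h := entropy δ with hh
  have hd : 0 < 1 / 2 - δ := by linarith
  set D : ℝ := 9 * (1 / 2 - δ) / (1 - h) with hD
  have hD0 : 0 ≤ D := by positivity
  obtain ⟨m₀, hm₀⟩ :=
    exists_forall_mul_log_le (4 / (1 - h) + (D + 1) / (1 / 2 - δ) + 8 * (D + 5))
  -- With `m` about `(K / ε) log (1 / ε)`, `log m` is up to `6 log K log (1 / ε)`, so the additive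
  -- radius `(D + 5) log m` is below `ε m` if `K` exceeds the multiple `8 (D + 5)` of `log K`.
  set K : ℝ := (m₀ : ℝ) with hK
  obtain ⟨hK6, hK1, hKlog⟩ := hm₀ m₀ le_rfl
  replace hK6 : 6 ≤ K := by rw [hK]; exact_mod_cast hK6
  have hKlog' : 8 * (D + 5) * Real.log K ≤ K := by
    refine le_trans ?_ hKlog
    gcongr
    exact le_add_of_nonneg_left (by positivity)
  set K' : ℝ := 6 * Real.log K with hK'
  have hK'0 : 0 < K' := by positivity
  refine ⟨10 * K * K' + 4, fun C hC ε hε hε2 => ?_⟩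
  have hC1 : 10 * K * K' ≤ C := by linarith
  have hC2 : 4 ≤ C := le_trans (le_add_of_nonneg_left (by positivity)) hC
  have hε1 : 2 ≤ 1 / ε := by rw [le_div_iff₀ hε]; linarith
  set Λ := Real.log (1 / ε) with hΛ
  have hΛ1 : 1 / 2 ≤ Λ := by
    have := Real.log_le_log (by norm_num) hε1
    linarith [Real.log_two_gt_d9]
  have hΛ0 : 0 < Λ := by linarith
  set m := ⌈K * (1 / ε * Λ)⌉₊ with hm
  have hmK : K * (1 / ε * Λ) ≤ m := Nat.le_ceil _
  have hKε : K ≤ K * (1 / ε * Λ) := by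
    have : 1 ≤ 1 / ε * Λ := by nlinarith
    nlinarith
  have hmm : (m : ℝ) ≤ 2 * K * (1 / ε * Λ) := by
    have h1 : (m : ℝ) < K * (1 / ε * Λ) + 1 := Nat.ceil_lt_add_one (by positivity)
    linarith
  obtain ⟨-, hlog1, hlog⟩ := hm₀ m (by
    have : (m₀ : ℝ) ≤ m := by linarith
    exact_mod_cast this)
  have hmpos : (0 : ℝ) < m := by linarith
  have hlogm : Real.log m ≤ K' * Λ := by
    have h1 := Real.log_le_log hmpos hmm
    rw [Real.log_mul (by positivity) (by positivity), Real.log_mul (by positivity) (by positivity),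
      Real.log_mul (by positivity) (by positivity)] at h1
    have h2 := Real.log_le_sub_one_of_pos hΛ0
    have h3 : Real.log 2 ≤ 1 := by linarith [Real.log_two_lt_d9]
    nlinarith
  have hlogε : (D + 5) * Real.log m ≤ ε * m := by
    calc (D + 5) * Real.log m ≤ (D + 5) * (K' * Λ) := by gcongr
      _ = 6 * (D + 5) * Real.log K * Λ := by rw [hK']; ring
      _ ≤ K * Λ := by
          gcongr
          refine le_trans ?_ hKlog'
          gcongr
          norm_num
      _ = ε * (K * (1 / ε * Λ)) := by field_simp
      _ ≤ ε * m := by gcongr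
  have hlogε' : (D + 5) * (Real.log m / m) ≤ ε := by
    rw [mul_div_assoc', div_le_iff₀ hmpos]
    exact hlogε
  rw [add_mul, add_mul] at hlog
  have hlog0 : 0 ≤ Real.log m := by linarith
  have hlogh : 4 * Real.log m ≤ (1 - h) * m := by
    have h1 : 4 / (1 - h) * Real.log m ≤ m := by
      have h2 : 0 ≤ (D + 1) / (1 / 2 - δ) * Real.log m := by positivity
      have h3 : 0 ≤ 8 * (D + 5) * Real.log m := by positivity
      linarith
    rw [div_mul_eq_mul_div, div_le_iff₀ hH1] at h1
    linarith
  have hlogd : (D + 1) * Real.log m ≤ (1 / 2 - δ) * m := by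
    have h1 : (D + 1) / (1 / 2 - δ) * Real.log m ≤ m := by
      have h2 : 0 ≤ 4 / (1 - h) * Real.log m := by positivity
      have h3 : 0 ≤ 8 * (D + 5) * Real.log m := by positivity
      linarith
    rw [div_mul_eq_mul_div, div_le_iff₀ hd] at h1
    linarith
  set a := ⌊(1 - h) * m - 3 * Real.log m⌋₊ with ha'
  have ha : 0 < a := Nat.floor_pos.2 (by linarith)
  have ha1 : (a : ℝ) ≤ (1 - h) * m - 3 * Real.log m := Nat.floor_le (by linarith)
  have ha2 : (1 - h) * m - 3 * Real.log m < a + 1 := Nat.lt_floor_add_one _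
  have ham : a < m := by
    have : (a : ℝ) < m := by nlinarith
    exact_mod_cast this
  obtain ⟨b, hab⟩ : ∃ b, a + b = m := ⟨m - a, by omega⟩
  have hb : 0 < b := by omega
  have habR : (a : ℝ) + b = m := by exact_mod_cast hab
  refine ⟨a, b, ha, hb, ?_, fun β => ⟨?_, ?_⟩⟩
  · rw [← Real.log_le_iff_le_exp (by rw [blockLength_one_eq ha]; positivity)]
    calc _ ≤ 5 * (m * Real.log m) := log_blockLength_le ha hab hlog1
      _ ≤ 5 * ((2 * K * (1 / ε * Λ)) * (K' * Λ)) := by gcongr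
      _ = 10 * K * K' * (1 / ε * Λ ^ 2) := by ring
      _ ≤ C * (1 / ε * Λ ^ 2) := by gcongr
  · refine (relCoveringRadius_construction_le_log hδ hδ2 ha hab hlog1 ?_ hlogd β).trans ?_
    · linarith
    · linarith
  · have hr := rate_construction_mem_Icc 1 β
    rw [hab] at hr
    push_cast at hr
    have ht := numRows_one_le ha hab hlog1
    refine ⟨hr.2.trans ?_, le_trans ?_ hr.1⟩
    · rw [div_le_iff₀ hmpos]
      linarith
    · rw [le_div_iff₀ hmpos, sub_mul]
      have h1 : 4 * Real.log m ≤ C * ε * m := by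
        have h2 : Real.log m ≤ ε * m :=
          (le_mul_of_one_le_left hlog0 (by linarith)).trans hlogε
        rw [mul_assoc]
        exact mul_le_mul hC2 h2 hlog0 (by linarith)
      linarith

/-- The gap in radius and rate is `O_δ(log m / m)`, and `log N` lies between `m` and `5 m log m`. -/
theorem exists_forall_construction_gap_le {δ : ℝ} (hδ : 0 < δ) (hδ2 : δ < 1 / 2) :
    ∃ C₀ : ℝ, ∀ C : ℝ, C₀ ≤ C →
      ∃ m₀ : ℕ, ∀ m a b : ℕ, m₀ ≤ m → a = ⌊(1 - entropy δ) * (m : ℝ)⌋₊ → a + b = m →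
        ∀ β : Module.Basis (Fin (max a b)) (ZMod 2) (GaloisField 2 (max a b)),
          relCoveringRadius (construction 1 a b β : Set (Coord 1 a b → ZMod 2))
            ≤ δ + C * (Real.log (Real.log (blockLength 1 a b : ℝ)) ^ 2
                / Real.log (blockLength 1 a b : ℝ)) ∧
          |rate (construction 1 a b β : Set (Coord 1 a b → ZMod 2)) - (1 - entropy δ)|
            ≤ C * (Real.log (Real.log (blockLength 1 a b : ℝ)) ^ 2
                / Real.log (blockLength 1 a b : ℝ)) := by
  have hH1 : 0 < 1 - entropy δ := by linarith [entropy_lt_one hδ2]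
  have hH0 := entropy_pos hδ hδ2
  set h := entropy δ with hh
  have hd : 0 < 1 / 2 - δ := by linarith
  set D : ℝ := 9 * (1 / 2 - δ) / (1 - h) with hD
  have hD0 : 0 ≤ D := by positivity
  obtain ⟨m₀, hm₀⟩ := exists_forall_mul_log_le (1 / (1 - h) + (D + 1) / (1 / 2 - δ))
  refine ⟨5 * (D + 5), fun C hC => ⟨m₀, fun m a b hm ha' hab β => ?_⟩⟩
  obtain ⟨hm6, hlog1, hlog⟩ := hm₀ m hm
  have hmpos : (0 : ℝ) < m := by exact_mod_cast (by omega : 0 < m)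
  have hlog0 : 0 ≤ Real.log m := by linarith
  rw [add_mul] at hlog
  have hlogh : Real.log m ≤ (1 - h) * m := by
    have h1 : 1 / (1 - h) * Real.log m ≤ m :=
      le_trans (le_add_of_nonneg_right (by positivity)) hlog
    rw [div_mul_eq_mul_div, div_le_iff₀ hH1] at h1
    linarith
  have hlogd : (D + 1) * Real.log m ≤ (1 / 2 - δ) * m := by
    have h1 : (D + 1) / (1 / 2 - δ) * Real.log m ≤ m :=
      le_trans (le_add_of_nonneg_left (by positivity)) hlog
    rw [div_mul_eq_mul_div, div_le_iff₀ hd] at h1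
    linarith
  have ha : 0 < a := by rw [ha']; exact Nat.floor_pos.2 (by linarith)
  have ha1 : (a : ℝ) ≤ (1 - h) * m := by rw [ha']; exact Nat.floor_le (by positivity)
  have ha2 : (1 - h) * m < a + 1 := by rw [ha']; exact Nat.lt_floor_add_one _
  have habR : (a : ℝ) + b = m := by exact_mod_cast hab
  have hN1 := le_log_blockLength ha hab hm6
  have hN2 := log_blockLength_le ha hab hlog1
  set N := Real.log (blockLength 1 a b : ℝ) with hN
  have hNpos : 0 < N := by linarith
  have hgap : Real.log m / m ≤ 5 * (Real.log N ^ 2 / N) := by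
    have h1 : Real.log m ^ 2 ≤ Real.log N ^ 2 := by
      gcongr
    rw [mul_div_assoc', div_le_div_iff₀ hmpos hNpos]
    calc Real.log m * N ≤ Real.log m * (5 * (m * Real.log m)) := by gcongr
      _ = 5 * Real.log m ^ 2 * m := by ring
      _ ≤ 5 * Real.log N ^ 2 * m := by gcongr
  have hC' : (D + 5) * (Real.log m / m) ≤ C * (Real.log N ^ 2 / N) := by
    calc _ ≤ (D + 5) * (5 * (Real.log N ^ 2 / N)) := by gcongr
      _ = 5 * (D + 5) * (Real.log N ^ 2 / N) := by ring
      _ ≤ _ := by gcongr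
  constructor
  · refine (relCoveringRadius_construction_le_log hδ hδ2 ha hab hlog1 ?_ hlogd β).trans ?_
    · linarith
    · linarith
  · refine le_trans ?_ hC'
    have hr := rate_construction_mem_Icc 1 β
    rw [hab] at hr
    push_cast at hr
    have ht := numRows_one_le ha hab hlog1
    have hq : 0 ≤ Real.log m / m := by positivity
    have hcancel : Real.log m / m * m = Real.log m := div_mul_cancel₀ _ hmpos.ne'
    have h1 : 1 - h - Real.log m / m ≤ a / m := by
      rw [le_div_iff₀ hmpos, sub_mul, hcancel]
      linarith
    have h2 : ((a : ℝ) + numRows 1 a b) / m ≤ 1 - h + 3 * (Real.log m / m) := by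
      rw [div_le_iff₀ hmpos, add_mul, mul_assoc, hcancel]
      linarith
    have h3 : 5 * (Real.log m / m) ≤ (D + 5) * (Real.log m / m) := by gcongr; linarith
    rw [abs_le]
    constructor <;> linarith [hr.1, hr.2]

end CoveringCode

theorem mainTheorem2 :
    ∃ c : ℝ, 0 < c ∧ ∀ δ : ℝ, 0 < δ → δ < 1 / 2 → ∃ C : ℝ, 0 < C ∧
      -- radius at most `δ + ε`, block length `exp (O ((1/ε) log (1/ε)))`
      (∀ ε : ℝ, 0 < ε → ε ≤ 1 / 2 → ∃ a b : ℕ, 0 < a ∧ 0 < b ∧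
        (CoveringCode.blockLength c a b : ℝ) ≤ Real.exp (C * ((1 / ε) * Real.log (1 / ε))) ∧
        ∀ β : Module.Basis (Fin (max a b)) (ZMod 2) (GaloisField 2 (max a b)),
          CoveringCode.relCoveringRadius
            (CoveringCode.construction c a b β : Set (CoveringCode.Coord c a b → ZMod 2)) ≤ δ + ε ∧
          |CoveringCode.rate
            (CoveringCode.construction c a b β : Set (CoveringCode.Coord c a b → ZMod 2))
            - (1 - CoveringCode.entropy δ)| ≤ C * (ε * Real.log (1 / ε))) ∧
      -- the same with rate at most `1 - H(δ)`
      (∀ ε : ℝ, 0 < ε → ε ≤ 1 / 2 → ∃ a b : ℕ, 0 < a ∧ 0 < b ∧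
        (CoveringCode.blockLength c a b : ℝ) ≤ Real.exp (C * ((1 / ε) * Real.log (1 / ε) ^ 2)) ∧
        ∀ β : Module.Basis (Fin (max a b)) (ZMod 2) (GaloisField 2 (max a b)),
          CoveringCode.relCoveringRadius
            (CoveringCode.construction c a b β : Set (CoveringCode.Coord c a b → ZMod 2)) ≤ δ + ε ∧
          CoveringCode.rate
            (CoveringCode.construction c a b β : Set (CoveringCode.Coord c a b → ZMod 2))
            ≤ 1 - CoveringCode.entropy δ ∧
          1 - CoveringCode.entropy δ - C * ε
            ≤ CoveringCode.rate
            (CoveringCode.construction c a b β : Set (CoveringCode.Coord c a b → ZMod 2))) ∧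
      -- the infinite family: the gap as a function of the block length
      (∃ m₀ : ℕ, ∀ m a b : ℕ, m₀ ≤ m → a = ⌊(1 - CoveringCode.entropy δ) * (m : ℝ)⌋₊ → a + b = m →
        ∀ β : Module.Basis (Fin (max a b)) (ZMod 2) (GaloisField 2 (max a b)),
          CoveringCode.relCoveringRadius
            (CoveringCode.construction c a b β : Set (CoveringCode.Coord c a b → ZMod 2))
            ≤ δ + C * (Real.log (Real.log (CoveringCode.blockLength c a b : ℝ)) ^ 2
                / Real.log (CoveringCode.blockLength c a b : ℝ)) ∧
          |CoveringCode.rate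
            (CoveringCode.construction c a b β : Set (CoveringCode.Coord c a b → ZMod 2))
            - (1 - CoveringCode.entropy δ)|
            ≤ C * (Real.log (Real.log (CoveringCode.blockLength c a b : ℝ)) ^ 2
                / Real.log (CoveringCode.blockLength c a b : ℝ))) := by
  refine ⟨1, one_pos, fun δ hδ hδ2 => ?_⟩
  obtain ⟨C₁, h₁⟩ := CoveringCode.exists_construction_excess_rate hδ hδ2
  obtain ⟨C₂, h₂⟩ := CoveringCode.exists_construction_rate_le hδ hδ2
  obtain ⟨C₃, h₃⟩ := CoveringCode.exists_forall_construction_gap_le hδ hδ2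
  refine ⟨max 1 (max C₁ (max C₂ C₃)), lt_max_of_lt_left one_pos, h₁ _ ?_, h₂ _ ?_, h₃ _ ?_⟩ <;> simp
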